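/- **Conventions.** A many-sorted signature $\Sigma$ consists of a nonempty set $\mathcal S_\Sigma$ of sorts, a set $\mathcal F_\Sigma$ of function symbols, each with an arity $(\sigma_1,\dots,\sigma_n,\sigma)$, and a set $\mathcal P_\Sigma$ of predicate symbols, each with an arity $(\sigma_1,\dots,\sigma_n)$, where $n\ge 0$ and the $\sigma_i,\sigma$ are sorts; $\mathcal P_\Sigma$ contains an equality symbol $=_\sigma$ of arity $(\sigma,\sigma)$ for every sort $\sigma$. Put $|\Sigma|=|\mathcal S_\Sigma|+|\mathcal F_\Sigma|+|\mathcal P_\Sigma|$. A $\Sigma$-structure $\mathbb A$ interprets each sort $\sigma$ as a nonempty set $\sigma^{\mathbb A}$, function and predicate symbols as functions and relations of the corresponding arity, and $=_\sigma$ as the identity on $\sigma^{\mathbb A}$. Two $\Sigma$-structures are elementarily equivalent if they satisfy the same first-order $\Sigma$-sentences. $\Sigma$ is split by $\Lambda$ into a family of signatures $\{\Sigma_\lambda:\lambda\in\Lambda\}$ if $\Lambda$ is a partition of $\mathcal S_\Sigma$ (into nonempty blocks), $\mathcal S_{\Sigma_\lambda}=\lambda$ for each $\lambda\in\Lambda$,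 $\mathcal F_\Sigma=\bigcup_{\lambda\in\Lambda}\mathcal F_{\Sigma_\lambda}$ and $\mathcal P_\Sigma=\bigcup_{\lambda\in\Lambda}\mathcal P_{\Sigma_\lambda}$ (with the same arities in $\Sigma_\lambda$ as in $\Sigma$). **Corollary (Combined Löwenheim–Skolem theorem, split signatures).** Suppose $\Sigma$ is split by $\Lambda$ into $\{\Sigma_\lambda:\lambda\in\Lambda\}$. Let $\mathbb A$ be a $\Sigma$-structure, and for each $\lambda\in\Lambda$ let $\kappa_\lambda$ be a cardinal with $\kappa_\lambda\ge\max\{|\Sigma_\lambda|,\aleph_0\}$. Then there is a $\Sigma$-structure $\mathbb B$ elementarily equivalent to $\mathbb A$ such that $|\sigma^{\mathbb B}|=\kappa_\lambda$ for every $\lambda\in\Lambda$ and every sort $\sigma\in\lambda$ with $\sigma^{\mathbb A}$ infinite, and $\sigma^{\mathbb B}=\sigma^{\mathbb A}$ for every sort $\sigma$ with $\sigma^{\mathbb A}$ finite. -/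

import Mathlib

universe u v

namespace ManySorted

open Cardinal

/-- A many-sorted first-order signature. The equality symbols `=_σ`, one for each sort `σ`, belong
to every signature and are not listed: `Rel` is the set of the other predicate symbols, and the set
of all predicate symbols is `Signature.Pred`. Arities may be zero. -/
structure Signature where
  Sorts : Type u
  sorts_nonempty : Nonempty Sorts
  Func : Type u
  funcArity : Func → ℕ
  funcDom : (f : Func) → Fin (funcArity f) → Sorts
  funcCod : Func → Sorts
  Rel : Type u
  relArity : Rel → ℕ
  relDom : (R : Rel) → Fin (relArity R) → Sorts

namespace Signature

/-- All predicate symbols: those of `Rel`, and the equality symbol of every sort. -/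
abbrev Pred (S : Signature.{u}) : Type u := S.Rel ⊕ S.Sorts

/-- The cardinality of a signature, `|S_Σ| + |F_Σ| + |P_Σ|`. -/
def card (S : Signature.{u}) : Cardinal.{u} := #S.Sorts + #S.Func + #S.Pred

/-- Terms of each sort. The variables of sort `σ` are `var σ n` for `n : ℕ`. -/
inductive Term (S : Signature.{u}) : S.Sorts → Type u
  | var (σ : S.Sorts) (n : ℕ) : Term S σ
  | app (f : S.Func) (ts : (i : Fin (S.funcArity f)) → Term S (S.funcDom f i)) :
      Term S (S.funcCod f)

/-- First-order formulas with equality, over the complete set of connectives `⊥`, `→`, `∀`. -/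
inductive Formula (S : Signature.{u}) : Type u
  | falsum : Formula S
  | equal (σ : S.Sorts) (s t : S.Term σ) : Formula S
  | rel (R : S.Rel) (ts : (i : Fin (S.relArity R)) → S.Term (S.relDom R i)) : Formula S
  | imp (φ ψ : Formula S) : Formula S
  | all (σ : S.Sorts) (n : ℕ) (φ : Formula S) : Formula S

variable {S : Signature.{u}}

/-- The variables that occur in a term; `(σ, n)` stands for the variable `var σ n`. -/
def Term.vars : {σ : S.Sorts} → S.Term σ → Set (S.Sorts × ℕ)
  | _, .var σ n => {(σ, n)}
  | _, .app _ ts => ⋃ i, (ts i).vars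

/-- The free variables of a formula. -/
def Formula.freeVars : S.Formula → Set (S.Sorts × ℕ)
  | .falsum => ∅
  | .equal _ s t => s.vars ∪ t.vars
  | .rel _ ts => ⋃ i, (ts i).vars
  | .imp φ ψ => φ.freeVars ∪ ψ.freeVars
  | .all σ n φ => φ.freeVars \ {(σ, n)}

/-- A sentence is a formula without free variables. -/
def Formula.IsSentence (φ : S.Formula) : Prop := φ.freeVars = ∅

/-- A structure: every sort is interpreted by a nonempty set. -/
structure Structure (S : Signature.{u}) where
  carrier : S.Sorts → Type v
  carrier_nonempty : ∀ σ, Nonempty (carrier σ)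
  funMap : (f : S.Func) → ((i : Fin (S.funcArity f)) → carrier (S.funcDom f i)) →
    carrier (S.funcCod f)
  relMap : (R : S.Rel) → ((i : Fin (S.relArity R)) → carrier (S.relDom R i)) → Prop

namespace Structure

/-- Assignments of values to the variables. -/
abbrev Assignment (A : Structure.{u, v} S) : Type (max u v) := (σ : S.Sorts) → ℕ → A.carrier σ

open Classical in
/-- The assignment that gives the variable `var σ n` the value `a` and agrees with `ν` on every
other variable. -/
noncomputable def Assignment.set {A : Structure.{u, v} S} (ν : A.Assignment) (σ : S.Sorts) (n : ℕ)
    (a : A.carrier σ) : A.Assignment :=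
  Function.update ν σ (Function.update (ν σ) n a)

/-- The value of a term under an assignment. -/
def eval (A : Structure.{u, v} S) (ν : A.Assignment) : {σ : S.Sorts} → S.Term σ → A.carrier σ
  | _, .var σ n => ν σ n
  | _, .app f ts => A.funMap f fun i => A.eval ν (ts i)

/-- Satisfaction of a formula under an assignment. -/
def Sat (A : Structure.{u, v} S) : A.Assignment → S.Formula → Prop
  | _, .falsum => False
  | ν, .equal _ s t => A.eval ν s = A.eval ν t
  | ν, .rel R ts => A.relMap R fun i => A.eval ν (ts i)
  | ν, .imp φ ψ => A.Sat ν φ → A.Sat ν ψ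
  | ν, .all σ n φ => ∀ a : A.carrier σ, A.Sat (ν.set σ n a) φ

/-- A structure satisfies a formula if every assignment does. -/
def Models (A : Structure.{u, v} S) (φ : S.Formula) : Prop := ∀ ν : A.Assignment, A.Sat ν φ

/-- Two structures are elementarily equivalent if they satisfy the same sentences. -/
def ElementarilyEquivalent (A B : Structure.{u, v} S) : Prop :=
  ∀ φ : S.Formula, φ.IsSentence → (A.Models φ ↔ B.Models φ)

/-- The sorts that `A` interprets by an infinite set. -/
def infiniteSorts (A : Structure.{u, v} S) : Set S.Sorts := {σ | ℵ₀ ≤ #(A.carrier σ)}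

/-- The sorts that `A` interprets by a finite set. -/
def finiteSorts (A : Structure.{u, v} S) : Set S.Sorts := (A.infiniteSorts)ᶜ

end Structure

/-- A signature contained in `S`: a nonempty set of sorts, a set of function symbols and a set of
predicate symbols of `S` with their arities, all sorts in these arities being among the chosen
sorts. The equality symbols of the chosen sorts are again implicit. -/
structure Subsignature (S : Signature.{u}) where
  sorts : Set S.Sorts
  sorts_nonempty : sorts.Nonempty
  funcs : Set S.Func
  funcDom_mem : ∀ f ∈ funcs, ∀ i, S.funcDom f i ∈ sorts
  funcCod_mem : ∀ f ∈ funcs, S.funcCod f ∈ sorts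
  rels : Set S.Rel
  relDom_mem : ∀ R ∈ rels, ∀ i, S.relDom R i ∈ sorts

/-- A subsignature as a signature in its own right. -/
def Subsignature.toSignature (T : Subsignature S) : Signature.{u} where
  Sorts := T.sorts
  sorts_nonempty := T.sorts_nonempty.to_subtype
  Func := T.funcs
  funcArity f := S.funcArity f
  funcDom f i := ⟨S.funcDom f i, T.funcDom_mem f f.2 i⟩
  funcCod f := ⟨S.funcCod f, T.funcCod_mem f f.2⟩
  Rel := T.rels
  relArity R := S.relArity R
  relDom R i := ⟨S.relDom R i, T.relDom_mem R R.2 i⟩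

/-- `S` is split by `Λ` into the family `T` of signatures: `Λ` is a partition of the set of sorts
(into nonempty blocks), the set of sorts of `T l` is the block `l`, and every symbol of `S` belongs
to some `T l`. For the equality symbols the last condition follows from the first two. -/
structure IsSplitBy (S : Signature.{u}) (Λ : Set (Set S.Sorts)) (T : Λ → Subsignature S) :
    Prop where
  isPartition : Setoid.IsPartition Λ
  sorts_eq : ∀ l : Λ, (T l).sorts = l
  iUnion_funcs : ⋃ l, (T l).funcs = Set.univ
  iUnion_rels : ⋃ l, (T l).rels = Set.univ

end Signature

end ManySorted

universe w

namespace ManySorted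

open Cardinal

namespace Signature

variable {S : Signature.{u}}

/-! The blocks are treated independently and then glued. For one block, a single cardinal `κ` is
needed (`exists_equivalent_mk_eq`): an ultrapower enlarges every infinite sort to at least `κ`
elements and leaves the finite sorts unchanged up to bijection. Then take the Skolem hull of `κ`
elements of each infinite sort and all elements of each finite one. There are at most `κ` Skolem
terms, so the infinite sorts get exactly `κ` elements.

Gluing (`IsSplitBy.exists_glue`) is possible because a symbol with a sort in its arity belongs to
only one block. Only predicate symbols of arity zero can be shared, and every block gives them their
truth value in `A`.

The glued structure is equivalent to `A` by a Feferman–Vaught argument (`IsSplitBy.exists_agree`).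
An atomic formula is decided within one block, and a quantifier moves a variable of one block only,
so it is absorbed by finitely many existential formulas of that block (`Agree.exists_set`).
Equivalence is carried for all formulas under fixed assignments, which avoids tracking free
variables. -/

lemma Term.finite_vars : ∀ {σ : S.Sorts} (t : S.Term σ), t.vars.Finite
  | _, .var _ _ => Set.finite_singleton _
  | _, .app _ ts => Set.finite_iUnion fun i => (ts i).finite_vars

/-- This makes Skolem functions finitary, although an assignment has infinitely many values. -/
lemma Formula.finite_freeVars (φ : S.Formula) : φ.freeVars.Finite := by
  induction φ with
  | falsum => exact Set.finite_empty
  | equal σ s t => exact s.finite_vars.union t.finite_vars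
  | rel R ts => exact Set.finite_iUnion fun i => (ts i).finite_vars
  | imp φ ψ hφ hψ => exact hφ.union hψ
  | all σ n φ hφ => exact hφ.subset Set.sdiff_subset

/-! ### Assignments, locality of satisfaction, isomorphisms -/

namespace Structure

lemma Assignment.set_same {A : Structure.{u, v} S} (ν : A.Assignment) (σ : S.Sorts) (n : ℕ)
    (a : A.carrier σ) : ν.set σ n a σ n = a := by
  simp [Assignment.set]

lemma Assignment.set_of_ne {A : Structure.{u, v} S} (ν : A.Assignment) {σ τ : S.Sorts} {n m : ℕ}
    (a : A.carrier σ) (h : (τ, m) ≠ (σ, n)) : ν.set σ n a τ m = ν τ m := by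
  by_cases hτ : τ = σ
  · subst hτ
    have hm : m ≠ n := fun hm => h (by rw [hm])
    simp [Assignment.set, hm]
  · simp [Assignment.set, hτ]

/-- A family of maps commutes with updating assignments. -/
lemma Assignment.map_set {A : Structure.{u, v} S} {B : Structure.{u, w} S}
    (h : ∀ σ, A.carrier σ → B.carrier σ) (ν : A.Assignment) (σ : S.Sorts) (n : ℕ)
    (a : A.carrier σ) :
    (fun τ m => h τ (ν.set σ n a τ m)) =
      Assignment.set (A := B) (fun τ m => h τ (ν τ m)) σ n (h σ a) := by
  funext τ m
  by_cases hv : (τ, m) = (σ, n)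
  · obtain ⟨rfl, rfl⟩ := Prod.mk.inj hv
    rw [Assignment.set_same, Assignment.set_same]
  · rw [Assignment.set_of_ne _ _ hv, Assignment.set_of_ne _ _ hv]

variable (A : Structure.{u, v} S)

lemma nonempty_assignment : Nonempty A.Assignment :=
  ⟨fun σ _ => (A.carrier_nonempty σ).some⟩

lemma eval_congr {ν μ : A.Assignment} : ∀ {σ : S.Sorts} (t : S.Term σ),
    (∀ p ∈ t.vars, ν p.1 p.2 = μ p.1 p.2) → A.eval ν t = A.eval μ t
  | _, .var σ n, h => h (σ, n) rfl
  | _, .app f ts, h => congrArg (A.funMap f) <| funext fun i =>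
      eval_congr (ts i) fun p hp => h p (Set.mem_iUnion_of_mem i hp)

lemma sat_congr (φ : S.Formula) : ∀ {ν μ : A.Assignment},
    (∀ p ∈ φ.freeVars, ν p.1 p.2 = μ p.1 p.2) → (A.Sat ν φ ↔ A.Sat μ φ) := by
  induction φ with
  | falsum => exact fun _ => Iff.rfl
  | equal σ s t =>
    intro ν μ h
    simp only [Sat]
    rw [A.eval_congr s fun p hp => h p (Or.inl hp), A.eval_congr t fun p hp => h p (Or.inr hp)]
  | rel R ts =>
    intro ν μ h
    simp only [Sat]
    rw [funext fun i => A.eval_congr (ts i) fun p hp => h p (Set.mem_iUnion_of_mem i hp)]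
  | imp φ ψ hφ hψ =>
    intro ν μ h
    exact imp_congr (hφ fun p hp => h p (Or.inl hp)) (hψ fun p hp => h p (Or.inr hp))
  | all σ n φ hφ =>
    intro ν μ h
    refine forall_congr' fun a => hφ fun p hp => ?_
    by_cases hv : p = (σ, n)
    · subst hv
      rw [Assignment.set_same, Assignment.set_same]
    · rw [Assignment.set_of_ne _ _ hv, Assignment.set_of_ne _ _ hv]
      exact h p ⟨hp, hv⟩

lemma models_iff_sat {φ : S.Formula} (hφ : φ.IsSentence) (ν : A.Assignment) :
    A.Models φ ↔ A.Sat ν φ := by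
  refine ⟨fun h => h ν, fun h μ => (A.sat_congr φ ?_).1 h⟩
  intro p hp
  rw [Formula.IsSentence] at hφ
  simp [hφ] at hp

/-- The condition that a family of bijections is an isomorphism. -/
structure IsIso {A : Structure.{u, v} S} {B : Structure.{u, w} S}
    (e : ∀ σ, A.carrier σ ≃ B.carrier σ) : Prop where
  map_fun : ∀ f x, e _ (A.funMap f x) = B.funMap f fun i => e _ (x i)
  map_rel : ∀ R x, A.relMap R x ↔ B.relMap R fun i => e _ (x i)

variable {A} {B : Structure.{u, w} S} {e : ∀ σ, A.carrier σ ≃ B.carrier σ}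

lemma IsIso.eval (he : IsIso e) (ν : A.Assignment) : ∀ {σ : S.Sorts} (t : S.Term σ),
    B.eval (fun σ n => e σ (ν σ n)) t = e σ (A.eval ν t)
  | _, .var _ _ => rfl
  | _, .app f ts => by
    simp only [Structure.eval]
    rw [he.map_fun, funext fun i => he.eval ν (ts i)]

lemma IsIso.sat (he : IsIso e) (φ : S.Formula) : ∀ ν : A.Assignment,
    A.Sat ν φ ↔ B.Sat (fun σ n => e σ (ν σ n)) φ := by
  induction φ with
  | falsum => exact fun _ => Iff.rfl
  | equal σ s t =>
    intro ν
    simp only [Sat]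
    rw [he.eval, he.eval, (e σ).apply_eq_iff_eq]
  | rel R ts =>
    intro ν
    simp only [Sat]
    rw [funext fun i => he.eval ν (ts i), he.map_rel]
  | imp φ ψ hφ hψ => exact fun ν => imp_congr (hφ ν) (hψ ν)
  | all σ n φ hφ =>
    intro ν
    simp only [Sat]
    rw [← (e σ).forall_congr_right]
    refine forall_congr' fun a => ?_
    rw [hφ, Assignment.map_set (B := B) (fun σ => e σ)]

end Structure

/-! ### The number of formulas -/

/-- The labels of the nodes of syntax trees. -/
abbrev Label (S : Signature.{u}) : Type u :=
  (S.Sorts × ℕ) ⊕ S.Func ⊕ ULift.{u} Bool ⊕ S.Sorts ⊕ S.Rel ⊕ (S.Sorts × ℕ)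

/-- The number of children of a node. -/
def labelArity : S.Label → ℕ
  | .inl _ => 0
  | .inr (.inl f) => S.funcArity f
  | .inr (.inr (.inl ⟨true⟩)) => 2
  | .inr (.inr (.inl ⟨false⟩)) => 0
  | .inr (.inr (.inr (.inl _))) => 2
  | .inr (.inr (.inr (.inr (.inl R)))) => S.relArity R
  | .inr (.inr (.inr (.inr (.inr _)))) => 1

/-- Syntax trees. -/
abbrev Tree (S : Signature.{u}) : Type u := WType fun a : S.Label => Fin (labelArity a)

/-- The syntax tree of a term. -/
def Term.tree : {σ : S.Sorts} → S.Term σ → S.Tree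
  | _, .var σ n => .mk (.inl (σ, n)) Fin.elim0
  | _, .app f ts => .mk (.inr (.inl f)) fun i => (ts i).tree

/-- The syntax tree of a formula. -/
def Formula.tree : S.Formula → S.Tree
  | .falsum => .mk (.inr (.inr (.inl ⟨false⟩))) Fin.elim0
  | .equal σ s t => .mk (.inr (.inr (.inr (.inl σ)))) ![s.tree, t.tree]
  | .rel R ts => .mk (.inr (.inr (.inr (.inr (.inl R))))) fun i => (ts i).tree
  | .imp φ ψ => .mk (.inr (.inr (.inl ⟨true⟩))) ![φ.tree, ψ.tree]
  | .all σ n φ => .mk (.inr (.inr (.inr (.inr (.inr (σ, n)))))) ![φ.tree]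

/-- The label of the root of a tree. -/
def Tree.label : S.Tree → S.Label
  | .mk a _ => a

/-- The head symbol of a term. -/
def Term.label : {σ : S.Sorts} → S.Term σ → S.Label
  | _, .var σ n => .inl (σ, n)
  | _, .app f _ => .inr (.inl f)

/-- The head symbol of a formula. -/
def Formula.label : S.Formula → S.Label
  | .falsum => .inr (.inr (.inl ⟨false⟩))
  | .equal σ _ _ => .inr (.inr (.inr (.inl σ)))
  | .rel R _ => .inr (.inr (.inr (.inr (.inl R))))
  | .imp _ _ => .inr (.inr (.inl ⟨true⟩))
  | .all σ n _ => .inr (.inr (.inr (.inr (.inr (σ, n)))))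

lemma Term.label_tree {σ : S.Sorts} (t : S.Term σ) : Tree.label t.tree = t.label := by
  cases t <;> rfl

lemma Formula.label_tree (φ : S.Formula) : Tree.label φ.tree = φ.label := by
  cases φ <;> rfl

lemma Tree.mk_inj {a : S.Label} {f g : Fin (labelArity a) → S.Tree}
    (h : (WType.mk a f : S.Tree) = WType.mk a g) : f = g := by
  injection h

/-- The sorts differ a priori: they are known to coincide only once the head symbols have been
compared. -/
lemma Term.tree_injective : ∀ {σ τ : S.Sorts} (s : S.Term σ) (t : S.Term τ),
    s.tree = t.tree → (⟨σ, s⟩ : Σ σ, S.Term σ) = ⟨τ, t⟩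
  | _, _, .var σ n, .var τ m, h => by
    have hl : (Term.var σ n).label = (Term.var τ m).label := by
      rw [← Term.label_tree, h, Term.label_tree]
    simp only [Term.label, Sum.inl.injEq, Prod.mk.injEq] at hl
    obtain ⟨rfl, rfl⟩ := hl
    rfl
  | _, _, .var σ n, .app f ts, h => by
    have hl : (Term.var σ n).label = (Term.app f ts).label := by
      rw [← Term.label_tree, h, Term.label_tree]
    simp [Term.label] at hl
  | _, _, .app f ts, .var σ n, h => by
    have hl : (Term.var σ n).label = (Term.app f ts).label := by
      rw [← Term.label_tree, ← h, Term.label_tree]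
    simp [Term.label] at hl
  | _, _, .app f ss, .app g ts, h => by
    have hl : (Term.app f ss).label = (Term.app g ts).label := by
      rw [← Term.label_tree, h, Term.label_tree]
    simp only [Term.label, Sum.inr.injEq, Sum.inl.injEq] at hl
    subst hl
    have h' := Tree.mk_inj h
    have : ss = ts := funext fun i => by
      have := Term.tree_injective (ss i) (ts i) (congrFun h' i)
      simpa using this
    rw [this]

lemma Term.eq_of_tree_eq {σ : S.Sorts} {s t : S.Term σ} (h : s.tree = t.tree) : s = t := by
  simpa using Term.tree_injective s t h

lemma Formula.tree_injective : Function.Injective (Formula.tree (S := S)) := by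
  intro φ
  induction φ with
  | falsum =>
    intro ψ h
    have hl := congrArg Tree.label h
    rw [label_tree, label_tree] at hl
    cases ψ with
    | falsum => rfl
    | _ => simp [Formula.label] at hl
  | equal σ s t =>
    intro ψ h
    have hl := congrArg Tree.label h
    rw [label_tree, label_tree] at hl
    cases ψ with
    | equal τ s' t' =>
      simp only [Formula.label, Sum.inr.injEq, Sum.inl.injEq] at hl
      subst hl
      have h' := Tree.mk_inj h
      rw [Term.eq_of_tree_eq (congrFun h' (0 : Fin 2)), Term.eq_of_tree_eq (congrFun h' (1 : Fin 2))]
    | _ => simp [Formula.label] at hl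
  | rel R ts =>
    intro ψ h
    have hl := congrArg Tree.label h
    rw [label_tree, label_tree] at hl
    cases ψ with
    | rel R' ts' =>
      simp only [Formula.label, Sum.inr.injEq, Sum.inl.injEq] at hl
      subst hl
      have h' := Tree.mk_inj h
      rw [funext fun i => Term.eq_of_tree_eq (congrFun h' i)]
    | _ => simp [Formula.label] at hl
  | imp φ χ hφ hχ =>
    intro ψ h
    have hl := congrArg Tree.label h
    rw [label_tree, label_tree] at hl
    cases ψ with
    | imp φ' χ' =>
      have h' := Tree.mk_inj h
      rw [hφ (congrFun h' (0 : Fin 2)), hχ (congrFun h' (1 : Fin 2))]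
    | _ => simp [Formula.label] at hl
  | all σ n φ hφ =>
    intro ψ h
    have hl := congrArg Tree.label h
    rw [label_tree, label_tree] at hl
    cases ψ with
    | all τ m φ' =>
      simp only [Formula.label, Sum.inr.injEq, Prod.mk.injEq] at hl
      obtain ⟨rfl, rfl⟩ := hl
      rw [hφ (congrFun (Tree.mk_inj h) (0 : Fin 1))]
    | _ => simp [Formula.label] at hl

lemma mk_sorts_le_card (S : Signature.{u}) : #S.Sorts ≤ S.card :=
  (self_le_add_right _ _).trans (self_le_add_right _ _)

lemma mk_func_le_card (S : Signature.{u}) : #S.Func ≤ S.card :=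
  (self_le_add_left _ _).trans (self_le_add_right _ _)

lemma mk_rel_le_card (S : Signature.{u}) : #S.Rel ≤ S.card := by
  refine le_trans ?_ (self_le_add_left _ _)
  rw [mk_sum, lift_id, lift_id]
  exact self_le_add_right _ _

/-- Formulas embed into finitely branching trees, and infinitely many labels give no more such trees
than labels. -/
lemma mk_formula_le (S : Signature.{u}) : #S.Formula ≤ max S.card ℵ₀ := by
  have hκ : ℵ₀ ≤ max S.card ℵ₀ := le_max_right _ _
  have hs : #S.Sorts ≤ max S.card ℵ₀ := S.mk_sorts_le_card.trans (le_max_left _ _)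
  have hv : #(S.Sorts × ℕ) ≤ max S.card ℵ₀ := by
    rw [mk_prod, mk_nat, lift_uzero, lift_aleph0]
    exact mul_le_of_le hκ hs hκ
  refine (mk_le_of_injective Formula.tree_injective).trans ?_
  refine WType.cardinalMk_le_max_aleph0_of_finite'.trans (max_le ?_ hκ)
  simp only [Label, mk_sum, lift_id, lift_uzero]
  refine add_le_of_le hκ hv (add_le_of_le hκ (S.mk_func_le_card.trans (le_max_left _ _))
    (add_le_of_le hκ ?_ (add_le_of_le hκ hs (add_le_of_le hκ
      (S.mk_rel_le_card.trans (le_max_left _ _)) hv))))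
  exact (lt_aleph0_of_finite _).le.trans hκ

namespace Structure

/-! ### Ultrapowers -/

section Ultrapower

variable {I : Type v} (U : Ultrafilter I)

/-- A function that represents a germ. -/
noncomputable def germRep {X : Type v} (x : (U : Filter I).Germ X) : I → X :=
  Quotient.out (s := Filter.germSetoid (U : Filter I) X) x

lemma coe_germRep {X : Type v} (x : (U : Filter I).Germ X) :
    ((germRep U x : I → X) : (U : Filter I).Germ X) = x :=
  Quotient.out_eq (s := Filter.germSetoid (U : Filter I) X) x

lemma germRep_coe {X : Type v} (f : I → X) :
    ∀ᶠ i in (U : Filter I), germRep U (f : (U : Filter I).Germ X) i = f i :=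
  Filter.Germ.coe_eq.1 (coe_germRep U _)

/-- The ultrapower of a many-sorted structure. -/
noncomputable def ultrapower (A : Structure.{u, v} S) : Structure.{u, v} S where
  carrier σ := (U : Filter I).Germ (A.carrier σ)
  carrier_nonempty σ := ⟨((fun _ => (A.carrier_nonempty σ).some : I → A.carrier σ) :
    (U : Filter I).Germ (A.carrier σ))⟩
  funMap f x := ((fun i => A.funMap f fun k => germRep U (x k) i : I → _) : (U : Filter I).Germ _)
  relMap R x := ∀ᶠ i in (U : Filter I), A.relMap R fun k => germRep U (x k) i

variable {A : Structure.{u, v} S}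

/-- The assignment in the ultrapower given by a family of assignments. -/
def germAssignment (r : I → A.Assignment) : (A.ultrapower U).Assignment :=
  fun σ n => ((fun i => r i σ n : I → A.carrier σ) : (U : Filter I).Germ (A.carrier σ))

lemma eval_germAssignment (r : I → A.Assignment) : ∀ {σ : S.Sorts} (t : S.Term σ),
    (A.ultrapower U).eval (germAssignment U r) t =
      ((fun i => A.eval (r i) t : I → A.carrier σ) : (U : Filter I).Germ (A.carrier σ))
  | _, .var _ _ => rfl
  | _, .app f ts => by
    refine Filter.Germ.coe_eq.2 ?_
    have h : ∀ k, ∀ᶠ i in (U : Filter I),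
        germRep U ((A.ultrapower U).eval (germAssignment U r) (ts k)) i = A.eval (r i) (ts k) :=
      fun k => by
        rw [eval_germAssignment r (ts k)]
        exact germRep_coe U _
    -- Each representative is correct on a set of the ultrafilter; arities are finite, so all are
    -- correct simultaneously on one such set.
    filter_upwards [Filter.eventually_all.2 h] with i hi
    exact congrArg (A.funMap f) (funext hi)

lemma germAssignment_set (r : I → A.Assignment) (σ : S.Sorts) (n : ℕ) (a : I → A.carrier σ) :
    germAssignment U (fun i => (r i).set σ n (a i)) =
      (germAssignment U r).set σ n (a : (U : Filter I).Germ (A.carrier σ)) := by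
  funext τ m
  by_cases hv : (τ, m) = (σ, n)
  · obtain ⟨rfl, rfl⟩ := Prod.mk.inj hv
    refine Eq.trans ?_ (Assignment.set_same (A := A.ultrapower U) _ _ _ _).symm
    exact Filter.Germ.coe_eq.2 (Filter.Eventually.of_forall fun i => Assignment.set_same _ _ _ _)
  · refine Eq.trans ?_ (Assignment.set_of_ne (A := A.ultrapower U) _ _ hv).symm
    exact Filter.Germ.coe_eq.2 (Filter.Eventually.of_forall fun i => Assignment.set_of_ne _ _ hv)

/-- Łoś's theorem. -/
lemma sat_germAssignment (φ : S.Formula) : ∀ r : I → A.Assignment,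
    (A.ultrapower U).Sat (germAssignment U r) φ ↔ ∀ᶠ i in (U : Filter I), A.Sat (r i) φ := by
  induction φ with
  | falsum => intro r; simp [Sat, U.neBot.ne]
  | equal σ s t =>
    intro r
    simp only [Sat]
    rw [eval_germAssignment, eval_germAssignment]
    exact Filter.Germ.coe_eq
  | rel R ts =>
    intro r
    have h : ∀ k, ∀ᶠ i in (U : Filter I),
        germRep U ((A.ultrapower U).eval (germAssignment U r) (ts k)) i = A.eval (r i) (ts k) :=
      fun k => by
        rw [eval_germAssignment U r (ts k)]
        exact germRep_coe U _
    refine Filter.eventually_congr ?_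
    filter_upwards [Filter.eventually_all.2 h] with i hi
    rw [funext hi]
    rfl
  | imp φ ψ hφ hψ =>
    intro r
    simp only [Sat]
    rw [hφ, hψ, Ultrafilter.eventually_imp]
  | all σ n φ hφ =>
    intro r
    simp only [Sat]
    constructor
    · intro h
      by_contra hc
      rw [← Ultrafilter.eventually_not] at hc
      -- A counterexample at every index that has one, and an arbitrary value elsewhere; its germ
      -- refutes `h`.
      have hw : ∀ i, ∃ a : A.carrier σ, (¬ ∀ a, A.Sat ((r i).set σ n a) φ) →
          ¬ A.Sat ((r i).set σ n a) φ := fun i => by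
        by_cases hi : ∀ a, A.Sat ((r i).set σ n a) φ
        · exact ⟨(A.carrier_nonempty σ).some, fun h => absurd hi h⟩
        · obtain ⟨a, ha⟩ := not_forall.1 hi
          exact ⟨a, fun _ => ha⟩
      choose a ha using hw
      have := h (a : (U : Filter I).Germ (A.carrier σ))
      rw [← germAssignment_set, hφ] at this
      obtain ⟨i, hi, hi'⟩ := (this.and hc).exists
      exact ha i hi' hi
    · intro h a
      rw [← coe_germRep U a, ← germAssignment_set, hφ]
      filter_upwards [h] with i hi
      exact hi _

end Ultrapower

/-- The fibres of a function into a finite set cover the index set, so one of them belongs to the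
ultrafilter. -/
lemma germ_const_bijective {I X : Type v} [Finite X] (U : Ultrafilter I) :
    Function.Bijective fun x : X => ((fun _ => x : I → X) : (U : Filter I).Germ X) := by
  constructor
  · intro x y h
    obtain ⟨i, hi⟩ := (Filter.Germ.coe_eq.1 h).exists
    exact hi
  · intro g
    induction g using Filter.Germ.inductionOn with
    | h f =>
      obtain ⟨x, hx⟩ := (Ultrafilter.eventually_exists_iff (f := U) (P := fun x i => x = f i)).1
        (Filter.Eventually.of_forall fun i => ⟨f i, rfl⟩)
      exact ⟨x, Filter.Germ.coe_eq.2 hx⟩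

/-- Each finite `F` has a map `c F` that is injective on `F`. The germs of `F ↦ c F k` are distinct
for distinct `k`, because almost every `F` contains any two given elements. -/
lemma exists_injective_germ {K X : Type v} [Infinite X] (U : Ultrafilter (Finset K))
    (hU : (U : Filter (Finset K)) ≤ Filter.atTop) :
    ∃ g : K → (U : Filter (Finset K)).Germ X, Function.Injective g := by
  classical
  have hX : ∀ F : Finset K, ∃ c : K → X, Set.InjOn c F := fun F => by
    obtain ⟨e⟩ : Nonempty (F ↪ X) := ⟨(Fintype.equivFin F).toEmbedding.trans
      (Fin.valEmbedding.trans (Infinite.natEmbedding X))⟩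
    obtain ⟨x⟩ : Nonempty X := inferInstance
    refine ⟨fun k => if h : k ∈ F then e ⟨k, h⟩ else x, fun k hk l hl h => ?_⟩
    rw [Finset.mem_coe] at hk hl
    simpa [hk, hl] using h
  choose c hc using hX
  refine ⟨fun k => ((fun F => c F k : Finset K → X) : (U : Filter (Finset K)).Germ X),
    fun k l h => ?_⟩
  obtain ⟨F, hF, hF'⟩ := ((Filter.Germ.coe_eq.1 h).and
    (hU (Filter.eventually_ge_atTop ({k, l} : Finset K)))).exists
  exact hc F (hF' (by simp)) (hF' (by simp)) hF

/-- Every structure has an elementary extension in which the infinite sorts have at least a given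
number of elements and the finite sorts have not changed. -/
lemma exists_large_extension (A : Structure.{u, v} S) (ν : A.Assignment) (K : Type v) :
    ∃ (C : Structure.{u, v} S) (μ : C.Assignment), (∀ φ, A.Sat ν φ ↔ C.Sat μ φ) ∧
      (∀ σ, Infinite (A.carrier σ) → ∃ g : K → C.carrier σ, Function.Injective g) ∧
      ∀ σ, Finite (A.carrier σ) → Nonempty (A.carrier σ ≃ C.carrier σ) := by
  classical
  -- The ultrafilter contains, for each finite set, the family of all finite sets above it.
  obtain ⟨U, hU⟩ := Ultrafilter.exists_le (Filter.atTop : Filter (Finset K))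
  refine ⟨A.ultrapower U, germAssignment U fun _ => ν, fun φ => ?_, fun σ _ => ?_, fun σ _ => ?_⟩
  · rw [sat_germAssignment]
    simp
  · exact exists_injective_germ U hU
  · exact ⟨Equiv.ofBijective _ (germ_const_bijective U)⟩

/-! ### Elementary substructures -/

/-- The structure induced on a family of nonempty sets closed under the functions. -/
def induced (C : Structure.{u, v} S) (X : ∀ σ, Set (C.carrier σ)) (hne : ∀ σ, (X σ).Nonempty)
    (hX : ∀ f x, (∀ i, x i ∈ X (S.funcDom f i)) → C.funMap f x ∈ X (S.funcCod f)) :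
    Structure.{u, v} S where
  carrier σ := X σ
  carrier_nonempty σ := (hne σ).to_subtype
  funMap f x := ⟨C.funMap f fun i => (x i).1, hX f _ fun i => (x i).2⟩
  relMap R x := C.relMap R fun i => (x i).1

section Induced

variable {C : Structure.{u, v} S} {X : ∀ σ, Set (C.carrier σ)} {hne : ∀ σ, (X σ).Nonempty}
  {hX : ∀ f x, (∀ i, x i ∈ X (S.funcDom f i)) → C.funMap f x ∈ X (S.funcCod f)}

lemma eval_induced (ν : (C.induced X hne hX).Assignment) : ∀ {σ : S.Sorts} (t : S.Term σ),
    ((C.induced X hne hX).eval ν t).1 = C.eval (fun σ n => (ν σ n).1) t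
  | _, .var _ _ => rfl
  | _, .app f ts => congrArg (C.funMap f) (funext fun i => eval_induced ν (ts i))

/-- The Tarski–Vaught test. -/
lemma sat_induced (htv : ∀ (φ : S.Formula) (σ : S.Sorts) (n : ℕ) (ν : C.Assignment),
      (∀ τ m, ν τ m ∈ X τ) → (∀ a ∈ X σ, C.Sat (ν.set σ n a) φ) → ∀ a, C.Sat (ν.set σ n a) φ)
    (φ : S.Formula) : ∀ ν : (C.induced X hne hX).Assignment,
      (C.induced X hne hX).Sat ν φ ↔ C.Sat (fun σ n => (ν σ n).1) φ := by
  induction φ with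
  | falsum => exact fun _ => Iff.rfl
  | equal σ s t =>
    intro ν
    simp only [Sat]
    rw [← eval_induced, ← eval_induced]
    exact Subtype.ext_iff
  | rel R ts =>
    intro ν
    simp only [Sat]
    rw [← funext fun i => eval_induced ν (ts i)]
    rfl
  | imp φ ψ hφ hψ => exact fun ν => imp_congr (hφ ν) (hψ ν)
  | all σ n φ hφ =>
    intro ν
    have key : ∀ a : X σ, (C.induced X hne hX).Sat (ν.set σ n a) φ ↔
        C.Sat (Assignment.set (A := C) (fun τ m => (ν τ m).1) σ n a.1) φ := fun a => by
      rw [hφ]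
      exact iff_of_eq (congrArg (C.Sat · φ)
        (Assignment.map_set (A := C.induced X hne hX) (B := C) (fun _ x => x.1) ν σ n a))
    constructor
    · intro h
      exact htv φ σ n _ (fun τ m => (ν τ m).2) fun a ha => (key ⟨a, ha⟩).1 (h ⟨a, ha⟩)
    · exact fun h a => (key a).2 (h a.1)

end Induced

/-! ### Skolem hulls -/

section Hull

variable (C : Structure.{u, v} S) {K : Type v} (g : ∀ σ, K → C.carrier σ)

/-- The labels of Skolem terms: generators, function symbols, and Skolem functions. -/
abbrev HullLabel (S : Signature.{u}) (K : Type v) : Type (max u v) :=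
  (S.Sorts × K) ⊕ S.Func ⊕ (S.Formula × S.Sorts × ℕ)

/-- The index sets of the arguments of a Skolem term. -/
def HullArity : HullLabel S K → Type u
  | .inl _ => PEmpty
  | .inr (.inl f) => ULift (Fin (S.funcArity f))
  | .inr (.inr (φ, _, _)) => φ.freeVars

/-- Finite arities are what bounds the number of Skolem terms. -/
instance : ∀ a : HullLabel S K, Finite (HullArity a)
  | .inl _ => inferInstanceAs (Finite PEmpty)
  | .inr (.inl f) => inferInstanceAs (Finite (ULift (Fin (S.funcArity f))))
  | .inr (.inr (φ, _, _)) => φ.finite_freeVars.to_subtype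

open Classical in
/-- The element `p.2` if it belongs to the sort `σ`, and `d` otherwise. -/
noncomputable def coord (p : Σ σ, C.carrier σ) (σ : S.Sorts) (d : C.carrier σ) : C.carrier σ :=
  if h : p.1 = σ then h ▸ p.2 else d

lemma coord_mk {σ : S.Sorts} (x d : C.carrier σ) : C.coord ⟨σ, x⟩ σ d = x := by
  simp [coord]

open Classical in
/-- A counterexample to `φ`, if there is one. -/
noncomputable def witness (φ : S.Formula) (σ : S.Sorts) (n : ℕ) (ν : C.Assignment) :
    C.carrier σ :=
  if h : ∃ a, ¬ C.Sat (ν.set σ n a) φ then h.choose else ν σ n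

variable (ν : C.Assignment)

open Classical in
/-- The value of a Skolem term in terms of the values of its arguments. -/
noncomputable def hullStep :
    (Σ a : HullLabel S K, HullArity a → Σ σ, C.carrier σ) → Σ σ, C.carrier σ
  | ⟨.inl (σ, k), _⟩ => ⟨σ, g σ k⟩
  | ⟨.inr (.inl f), c⟩ => ⟨S.funcCod f, C.funMap f fun i => C.coord (c ⟨i⟩) _ (ν _ 0)⟩
  | ⟨.inr (.inr (φ, σ, n)), c⟩ => ⟨σ, C.witness φ σ n fun τ m =>
      if h : (τ, m) ∈ φ.freeVars then C.coord (c ⟨(τ, m), h⟩) τ (ν τ m) else ν τ m⟩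

/-- The value of a Skolem term. -/
noncomputable def hullEval : WType (HullArity (S := S) (K := K)) → Σ σ, C.carrier σ :=
  WType.elim _ (C.hullStep g ν)

/-- The set of the values of Skolem terms of a sort. -/
def hull (σ : S.Sorts) : Set (C.carrier σ) := {x | ∃ t, C.hullEval g ν t = ⟨σ, x⟩}

lemma mem_hull (σ : S.Sorts) (k : K) : g σ k ∈ C.hull g ν σ :=
  ⟨.mk (.inl (σ, k)) PEmpty.elim, rfl⟩

lemma funMap_mem_hull (f : S.Func) (x : ∀ i, C.carrier (S.funcDom f i))
    (hx : ∀ i, x i ∈ C.hull g ν (S.funcDom f i)) : C.funMap f x ∈ C.hull g ν (S.funcCod f) := by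
  choose c hc using hx
  refine ⟨.mk (.inr (.inl f)) fun i : ULift (Fin (S.funcArity f)) => c i.down, ?_⟩
  simp only [hullEval, WType.elim] at hc ⊢
  simp only [hullStep]
  simp only [hc, coord_mk]

/-- The hull contains a counterexample as soon as there is one at all, namely the value of the
Skolem function of `φ`, `σ`, `n`. -/
lemma hull_tarskiVaught (φ : S.Formula) (σ : S.Sorts) (n : ℕ) (μ : C.Assignment)
    (hμ : ∀ τ m, μ τ m ∈ C.hull g ν τ) (h : ∀ a ∈ C.hull g ν σ, C.Sat (μ.set σ n a) φ)
    (a : C.carrier σ) : C.Sat (μ.set σ n a) φ := by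
  classical
  choose c hc using hμ
  -- A Skolem function takes only the values at free variables as arguments and reads the others
  -- from `ν`, so `μ` is first replaced by `ν` off the free variables; this does not affect `φ`.
  set μ' : C.Assignment := fun τ m => if (τ, m) ∈ φ.freeVars then μ τ m else ν τ m with hμ'
  have hmem : C.witness φ σ n μ' ∈ C.hull g ν σ := by
    refine ⟨.mk (.inr (.inr (φ, σ, n))) fun p : φ.freeVars => c p.1.1 p.1.2, ?_⟩
    simp only [hullEval, WType.elim] at hc ⊢
    simp only [hullStep]
    simp only [hc, coord_mk, hμ', dite_eq_ite]
  have hcongr : ∀ b, C.Sat (μ.set σ n b) φ ↔ C.Sat (μ'.set σ n b) φ := fun b =>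
    C.sat_congr φ fun p hp => by
      by_cases hv : p = (σ, n)
      · subst hv
        rw [Assignment.set_same, Assignment.set_same]
      · rw [Assignment.set_of_ne _ _ hv, Assignment.set_of_ne _ _ hv]
        simp [hμ', hp]
  by_contra ha
  have hex : ∃ a, ¬ C.Sat (μ'.set σ n a) φ := ⟨a, fun h => ha ((hcongr a).2 h)⟩
  have hw : ¬ C.Sat (μ'.set σ n (C.witness φ σ n μ')) φ := by
    rw [witness, dif_pos hex]
    exact hex.choose_spec
  exact hw ((hcongr _).1 (h _ hmem))

/-- Choosing a Skolem term for each element embeds the hull into the set of Skolem terms, which are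
finitely branching trees over at most `κ` labels. -/
lemma mk_hull_le {κ : Cardinal.{max u v}} (hκ : ℵ₀ ≤ κ) (hS : lift.{v} S.card ≤ κ)
    (hK : lift.{u} #K ≤ κ) (σ : S.Sorts) : lift.{u} #(C.hull g ν σ) ≤ κ := by
  have hW : #(WType (HullArity (S := S) (K := K))) ≤ κ := by
    refine WType.cardinalMk_le_max_aleph0_of_finite'.trans (max_le ?_ hκ)
    have hs : lift.{v} #S.Sorts ≤ κ := (lift_le.2 S.mk_sorts_le_card).trans hS
    have hf : lift.{v} #S.Func ≤ κ := (lift_le.2 S.mk_func_le_card).trans hS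
    have hφ : lift.{v} #S.Formula ≤ κ := by
      refine (lift_le.2 S.mk_formula_le).trans ?_
      rw [lift_max, lift_aleph0]
      exact max_le hS hκ
    simp only [HullLabel, mk_sum, mk_prod, mk_nat, lift_add, lift_mul, lift_lift, lift_aleph0]
    rw [← lift_umax.{u, v}] at hs hf hφ
    exact add_le_of_le hκ (mul_le_of_le hκ hs hK)
      (add_le_of_le hκ hf (mul_le_of_le hκ hφ (mul_le_of_le hκ hs hκ)))
  choose c hc using fun x : C.hull g ν σ => x.2
  have hinj : Function.Injective c := fun x y h => by
    have := (hc x).symm.trans ((congrArg _ h).trans (hc y))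
    exact Subtype.ext (by simpa using this)
  have h := lift_mk_le_lift_mk_of_injective hinj
  rw [lift_umax.{v, u}, lift_id'.{v, max u v}] at h
  exact h.trans hW

end Hull

/-- The combined Löwenheim–Skolem theorem for a single cardinal. -/
lemma exists_equivalent_mk_eq (A : Structure.{u, v} S) (ν : A.Assignment) (κ : Cardinal.{v})
    (hκ : max (lift.{v} S.card) ℵ₀ ≤ lift.{u} κ) :
    ∃ (B : Structure.{u, v} S) (μ : B.Assignment), (∀ φ, A.Sat ν φ ↔ B.Sat μ φ) ∧
      (∀ σ, Infinite (A.carrier σ) → #(B.carrier σ) = κ) ∧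
      ∀ σ, Finite (A.carrier σ) → Nonempty (A.carrier σ ≃ B.carrier σ) := by
  have hκ₀ : ℵ₀ ≤ κ := by
    rw [← lift_le.{u}, lift_aleph0]
    exact (le_max_right _ _).trans hκ
  obtain ⟨C, μ, hsat, hinf, hfin⟩ := exists_large_extension A ν κ.out
  have : Infinite κ.out := by rw [infinite_iff, mk_out]; exact hκ₀
  -- Injectivity gives the lower bound for the infinite sorts; surjectivity puts all of a finite
  -- sort into the hull.
  have hg : ∀ σ, ∃ g : κ.out → C.carrier σ, (Infinite (A.carrier σ) → Function.Injective g) ∧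
      (Finite (A.carrier σ) → Function.Surjective g) := fun σ => by
    rcases finite_or_infinite (A.carrier σ) with h | h
    · obtain ⟨e⟩ := hfin σ h
      have : Finite (C.carrier σ) := Finite.of_equiv _ e
      have : Nonempty (C.carrier σ) := C.carrier_nonempty σ
      have hle : #(C.carrier σ) ≤ #κ.out := by
        rw [mk_out]
        exact (lt_aleph0_of_finite _).le.trans hκ₀
      obtain ⟨j⟩ := hle
      exact ⟨Function.invFun j, fun hi => absurd h (not_finite_iff_infinite.2 hi),
        fun _ => Function.invFun_surjective j.injective⟩
    · obtain ⟨g, hg⟩ := hinf σ h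
      exact ⟨g, fun _ => hg, fun hf => absurd hf (not_finite_iff_infinite.2 h)⟩
  choose g hgi hgs using hg
  -- The values of `μ` are added as generators so that `μ` is an assignment in the hull.
  let g' : ∀ σ, κ.out ⊕ ULift.{v} ℕ → C.carrier σ := fun σ => Sum.elim (g σ) fun m => μ σ m.down
  have hmem : ∀ σ k, g σ k ∈ C.hull g' μ σ := fun σ k => C.mem_hull g' μ σ (Sum.inl k)
  have hmem' : ∀ σ n, μ σ n ∈ C.hull g' μ σ := fun σ n => C.mem_hull g' μ σ (Sum.inr ⟨n⟩)
  refine ⟨C.induced (C.hull g' μ) (fun σ => ⟨_, hmem' σ 0⟩) (C.funMap_mem_hull g' μ),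
    fun σ n => ⟨μ σ n, hmem' σ n⟩, fun φ => ?_, fun σ h => ?_, fun σ h => ?_⟩
  · exact (hsat φ).trans (sat_induced (C.hull_tarskiVaught g' μ) φ
      fun σ n => ⟨μ σ n, hmem' σ n⟩).symm
  · refine le_antisymm ?_ ?_
    · rw [← lift_le.{u}]
      refine C.mk_hull_le g' μ ((le_max_right _ _).trans hκ) ((le_max_left _ _).trans hκ) ?_ σ
      rw [lift_le, mk_sum, lift_id, lift_id, mk_out, mk_uLift, mk_nat, lift_aleph0]
      exact add_le_of_le hκ₀ le_rfl hκ₀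
    · have hle := mk_le_of_injective (f := fun k => (⟨g σ k, hmem σ k⟩ : C.hull g' μ σ))
        fun k l hkl => hgi σ h (congrArg Subtype.val hkl)
      rwa [mk_out] at hle
  · obtain ⟨e⟩ := hfin σ h
    have huniv : C.hull g' μ σ = Set.univ := Set.eq_univ_of_forall fun x => by
      obtain ⟨k, rfl⟩ := hgs σ h x
      exact hmem σ k
    exact ⟨e.trans ((Equiv.Set.univ _).symm.trans (Equiv.setCongr huniv.symm))⟩

/-! ### Reducts -/

/-- The reduct of a structure to a subsignature. -/
def reduct (A : Structure.{u, v} S) (T : Subsignature S) : Structure.{u, v} T.toSignature where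
  carrier σ := A.carrier σ.1
  carrier_nonempty σ := A.carrier_nonempty σ.1
  funMap f x := A.funMap f.1 x
  relMap R x := A.relMap R.1 x

variable {A : Structure.{u, v} S}

/-- The restriction of an assignment to the sorts of a subsignature. -/
def Assignment.restrict (ν : A.Assignment) (T : Subsignature S) : (A.reduct T).Assignment :=
  fun σ n => ν σ.1 n

lemma Assignment.restrict_set (ν : A.Assignment) {T : Subsignature S} {σ : S.Sorts}
    (hσ : σ ∈ T.sorts) (n : ℕ) (a : A.carrier σ) :
    (ν.set σ n a).restrict T =
      Assignment.set (A := A.reduct T) (ν.restrict T) (⟨σ, hσ⟩ : T.sorts) n a := by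
  funext τ m
  by_cases hv : (τ, m) = ((⟨σ, hσ⟩ : T.sorts), n)
  · obtain ⟨rfl, rfl⟩ := Prod.mk.inj hv
    exact (Assignment.set_same ν σ m a).trans
      (Assignment.set_same (A := A.reduct T) (ν.restrict T) (⟨σ, hσ⟩ : T.sorts) m a).symm
  · refine Eq.trans ?_ (Assignment.set_of_ne (A := A.reduct T) (ν.restrict T) _ hv).symm
    refine Assignment.set_of_ne ν a fun h => hv ?_
    obtain ⟨h₁, h₂⟩ := Prod.mk.inj h
    exact Prod.ext (Subtype.ext h₁) h₂

lemma Assignment.restrict_set_of_notMem (ν : A.Assignment) {T : Subsignature S} {σ : S.Sorts}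
    (hσ : σ ∉ T.sorts) (n : ℕ) (a : A.carrier σ) :
    (ν.set σ n a).restrict T = ν.restrict T := by
  funext τ m
  refine Assignment.set_of_ne ν a fun h => hσ ?_
  rw [← (Prod.mk.inj h).1]
  exact τ.2

end Structure

open Structure

/-- Under `hT` a term whose sort is in `T` never leaves `T`. The restricted term is chosen before
`A` and `ν`, so the same one serves for both structures being compared. -/
lemma Term.exists_restrict {T : Subsignature S}
    (hT : ∀ f, S.funcCod f ∈ T.sorts → f ∈ T.funcs) :
    ∀ {σ : S.Sorts} (t : S.Term σ) (hσ : σ ∈ T.sorts),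
      ∃ t' : T.toSignature.Term (⟨σ, hσ⟩ : T.sorts), ∀ (A : Structure.{u, v} S) (ν : A.Assignment),
        (A.reduct T).eval (ν.restrict T) t' = A.eval ν t
  | _, .var σ n, hσ => ⟨.var (S := T.toSignature) (⟨σ, hσ⟩ : T.sorts) n, fun _ _ => rfl⟩
  | _, .app f ts, hσ => by
    choose ts' hts' using fun i =>
      exists_restrict hT (ts i) (T.funcDom_mem f (hT f hσ) i)
    exact ⟨.app (S := T.toSignature) (⟨f, hT f hσ⟩ : T.funcs) ts', fun A ν =>
      congrArg (A.funMap f) (funext fun i => hts' i A ν)⟩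

/-! ### Complete conjunctions -/

namespace Formula

/-- Negation. -/
def neg (φ : S.Formula) : S.Formula := .imp φ .falsum

/-- Conjunction. -/
def and (φ ψ : S.Formula) : S.Formula := neg (.imp φ (neg ψ))

/-- Existential quantification. -/
def ex (σ : S.Sorts) (n : ℕ) (φ : S.Formula) : S.Formula := neg (.all σ n (neg φ))

variable {A : Structure.{u, v} S}

@[simp]
lemma sat_neg {ν : A.Assignment} {φ : S.Formula} : A.Sat ν φ.neg ↔ ¬ A.Sat ν φ := Iff.rfl

@[simp]
lemma sat_and {ν : A.Assignment} {φ ψ : S.Formula} :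
    A.Sat ν (φ.and ψ) ↔ A.Sat ν φ ∧ A.Sat ν ψ := by
  simp [and, Sat]

@[simp]
lemma sat_ex {ν : A.Assignment} {σ : S.Sorts} {n : ℕ} {φ : S.Formula} :
    A.Sat ν (φ.ex σ n) ↔ ∃ a, A.Sat (ν.set σ n a) φ := by
  simp [ex, Sat]

/-- The conjunctions that contain each formula of a list or its negation. -/
def completeConjunctions : List S.Formula → List S.Formula
  | [] => [neg .falsum]
  | ψ :: L => (completeConjunctions L).map (and ψ) ++ (completeConjunctions L).map (and ψ.neg)

lemma exists_sat_completeConjunctions (ν : A.Assignment) :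
    ∀ L : List S.Formula, ∃ t ∈ completeConjunctions L, A.Sat ν t
  | [] => ⟨_, List.mem_singleton.2 rfl, id⟩
  | ψ :: L => by
    obtain ⟨t, ht, hν⟩ := exists_sat_completeConjunctions ν L
    by_cases hψ : A.Sat ν ψ
    · exact ⟨ψ.and t, List.mem_append_left _ (List.mem_map_of_mem ht), sat_and.2 ⟨hψ, hν⟩⟩
    · exact ⟨ψ.neg.and t, List.mem_append_right _ (List.mem_map_of_mem ht), sat_and.2 ⟨hψ, hν⟩⟩

/-- Each formula of the list or its negation is a conjunct of `t`, so `t` fixes all their truth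
values. -/
lemma sat_iff_of_sat_completeConjunctions {B : Structure.{u, w} S} {ν : A.Assignment}
    {μ : B.Assignment} : ∀ {L : List S.Formula} {t : S.Formula}, t ∈ completeConjunctions L →
      A.Sat ν t → B.Sat μ t → ∀ ψ ∈ L, (A.Sat ν ψ ↔ B.Sat μ ψ)
  | [], _, _, _, _ => by simp
  | χ :: L, t, ht, hA, hB => by
    rw [completeConjunctions, List.mem_append, List.mem_map, List.mem_map] at ht
    intro ψ hψ
    rcases ht with ⟨t, ht, rfl⟩ | ⟨t, ht, rfl⟩ <;> rw [sat_and] at hA hB <;>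
      rcases List.mem_cons.1 hψ with rfl | hψ
    · exact iff_of_true hA.1 hB.1
    · exact sat_iff_of_sat_completeConjunctions ht hA.2 hB.2 ψ hψ
    · exact iff_of_false hA.1 hB.1
    · exact sat_iff_of_sat_completeConjunctions ht hA.2 hB.2 ψ hψ

end Formula

/-! ### Split signatures -/

section Split

variable {Λ : Set (Set S.Sorts)} {T : Λ → Subsignature S}

lemma IsSplitBy.exists_mem_sorts (h : S.IsSplitBy Λ T) (σ : S.Sorts) : ∃ l, σ ∈ (T l).sorts := by
  obtain ⟨b, ⟨hb, hσ⟩, -⟩ := h.isPartition.2 σ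
  exact ⟨⟨b, hb⟩, by rwa [h.sorts_eq]⟩

lemma IsSplitBy.eq_of_mem_sorts (h : S.IsSplitBy Λ T) {σ : S.Sorts} {l m : Λ}
    (hl : σ ∈ (T l).sorts) (hm : σ ∈ (T m).sorts) : l = m := by
  rw [h.sorts_eq] at hl hm
  exact Subtype.ext ((h.isPartition.2 σ).unique ⟨l.2, hl⟩ ⟨m.2, hm⟩)

lemma IsSplitBy.exists_mem_funcs (h : S.IsSplitBy Λ T) (f : S.Func) : ∃ l, f ∈ (T l).funcs :=
  Set.mem_iUnion.1 (h.iUnion_funcs ▸ Set.mem_univ f)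

lemma IsSplitBy.exists_mem_rels (h : S.IsSplitBy Λ T) (R : S.Rel) : ∃ l, R ∈ (T l).rels :=
  Set.mem_iUnion.1 (h.iUnion_rels ▸ Set.mem_univ R)

/-- The codomain is a sort of every block that contains `f`, and blocks are disjoint. -/
lemma IsSplitBy.mem_funcs (h : S.IsSplitBy Λ T) {l : Λ} {f : S.Func}
    (hf : S.funcCod f ∈ (T l).sorts) : f ∈ (T l).funcs := by
  obtain ⟨m, hm⟩ := h.exists_mem_funcs f
  rwa [h.eq_of_mem_sorts hf ((T m).funcCod_mem f hm)]

variable (T) in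
/-- Two structures with assignments agree on the given formulas of each block. -/
def Agree (Φ : ∀ l, List (T l).toSignature.Formula) (A : Structure.{u, v} S) (ν : A.Assignment)
    (B : Structure.{u, w} S) (μ : B.Assignment) : Prop :=
  ∀ l, ∀ ψ ∈ Φ l, ((A.reduct (T l)).Sat (ν.restrict (T l)) ψ ↔
    (B.reduct (T l)).Sat (μ.restrict (T l)) ψ)

lemma Agree.symm {Φ : ∀ l, List (T l).toSignature.Formula} {A : Structure.{u, v} S}
    {ν : A.Assignment} {B : Structure.{u, w} S} {μ : B.Assignment} (h : Agree T Φ A ν B μ) :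
    Agree T Φ B μ A ν :=
  fun l ψ hψ => (h l ψ hψ).symm

open Classical in
/-- The formulas that control the given formulas after a change of the variable `(σ, n)`. -/
noncomputable def exStep {l : Λ} (σ : (T l).sorts) (n : ℕ)
    (Φ : ∀ l, List (T l).toSignature.Formula) : ∀ l, List (T l).toSignature.Formula :=
  Function.update Φ l ((Formula.completeConjunctions (Φ l)).map
    (Formula.ex (S := (T l).toSignature) σ n))

/-- This is the back-and-forth step: the complete conjunction that holds at `b` is realized in `A`
too, because its existential closure in the moved variable is among the formulas agreed on. -/
lemma Agree.exists_set (h : S.IsSplitBy Λ T) {l : Λ} {σ : S.Sorts} (hσ : σ ∈ (T l).sorts) {n : ℕ}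
    {Φ : ∀ l, List (T l).toSignature.Formula} {A : Structure.{u, v} S}
    {ν : A.Assignment} {B : Structure.{u, w} S} {μ : B.Assignment}
    (hΦ : Agree T (exStep ⟨σ, hσ⟩ n Φ) A ν B μ) (b : B.carrier σ) :
    ∃ a, Agree T Φ A (ν.set σ n a) B (μ.set σ n b) := by
  obtain ⟨t, ht, hb⟩ := Formula.exists_sat_completeConjunctions ((μ.set σ n b).restrict (T l)) (Φ l)
  have hl := hΦ l (Formula.ex (S := (T l).toSignature) (⟨σ, hσ⟩ : (T l).sorts) n t) (by
    rw [exStep, Function.update_self]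
    exact List.mem_map_of_mem ht)
  rw [Assignment.restrict_set _ hσ] at hb
  obtain ⟨a, ha⟩ : ∃ a : A.carrier σ, (A.reduct (T l)).Sat (Assignment.set (A := A.reduct (T l))
      (ν.restrict (T l)) (⟨σ, hσ⟩ : (T l).sorts) n a) t :=
    (Formula.sat_ex.symm.trans (hl.trans Formula.sat_ex)).2 ⟨b, hb⟩
  refine ⟨a, fun m => ?_⟩
  by_cases hm : m = l
  · subst hm
    rw [Assignment.restrict_set ν hσ, Assignment.restrict_set μ hσ]
    exact Formula.sat_iff_of_sat_completeConjunctions ht ha hb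
  -- The other blocks do not see the moved variable.
  · have hσm : σ ∉ (T m).sorts := fun h' => hm (h.eq_of_mem_sorts h' hσ)
    rw [Assignment.restrict_set_of_notMem ν hσm, Assignment.restrict_set_of_notMem μ hσm]
    have := hΦ m
    rwa [exStep, Function.update_of_ne hm] at this

/-- The truth value of a formula over a split signature is determined by the truth values of
finitely many formulas of each block. -/
lemma IsSplitBy.exists_agree (h : S.IsSplitBy Λ T) (φ : S.Formula) :
    ∃ Φ : ∀ l, List (T l).toSignature.Formula, ∀ (A : Structure.{u, v} S) (ν : A.Assignment)
      (B : Structure.{u, v} S) (μ : B.Assignment), Agree T Φ A ν B μ →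
        (A.Sat ν φ ↔ B.Sat μ φ) := by
  classical
  induction φ with
  | falsum => exact ⟨fun _ => [], fun _ _ _ _ _ => Iff.rfl⟩
  | equal σ s t =>
    obtain ⟨l, hl⟩ := h.exists_mem_sorts σ
    obtain ⟨s', hs'⟩ := Term.exists_restrict.{u, v} (fun _ => h.mem_funcs) s hl
    obtain ⟨t', ht'⟩ := Term.exists_restrict.{u, v} (fun _ => h.mem_funcs) t hl
    refine ⟨Function.update (fun _ => []) l
      [Formula.equal (S := (T l).toSignature) (⟨σ, hl⟩ : (T l).sorts) s' t'],
      fun A ν B μ hΦ => ?_⟩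
    have := hΦ l _ (by rw [Function.update_self]; exact List.mem_singleton.2 rfl)
    simp only [Sat] at this ⊢
    rwa [hs', hs', ht', ht'] at this
  | rel R ts =>
    obtain ⟨l, hl⟩ := h.exists_mem_rels R
    choose ts' hts' using fun i =>
      Term.exists_restrict.{u, v} (fun _ => h.mem_funcs) (ts i) ((T l).relDom_mem R hl i)
    refine ⟨Function.update (fun _ => []) l
      [Formula.rel (S := (T l).toSignature) (⟨R, hl⟩ : (T l).rels) ts'], fun A ν B μ hΦ => ?_⟩
    have := hΦ l _ (by rw [Function.update_self]; exact List.mem_singleton.2 rfl)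
    have hR : ∀ (M : Structure.{u, v} S) (ξ : M.Assignment),
        (M.reduct (T l)).Sat (ξ.restrict (T l))
          (Formula.rel (S := (T l).toSignature) (⟨R, hl⟩ : (T l).rels) ts') ↔
        M.Sat ξ (.rel R ts) := fun M ξ =>
      iff_of_eq (congrArg (M.relMap R) (funext fun i => hts' i M ξ))
    rwa [hR, hR] at this
  | imp φ ψ hφ hψ =>
    obtain ⟨Φ, hΦ⟩ := hφ
    obtain ⟨Ψ, hΨ⟩ := hψ
    exact ⟨fun l => Φ l ++ Ψ l, fun A ν B μ hA => imp_congr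
      (hΦ A ν B μ fun l χ hχ => hA l χ (List.mem_append_left _ hχ))
      (hΨ A ν B μ fun l χ hχ => hA l χ (List.mem_append_right _ hχ))⟩
  | all σ n φ hφ =>
    obtain ⟨Φ, hΦ⟩ := hφ
    obtain ⟨l, hl⟩ := h.exists_mem_sorts σ
    -- Every element of either structure is matched by one of the other that restores agreement on
    -- `Φ`.
    refine ⟨exStep ⟨σ, hl⟩ n Φ, fun A ν B μ hA => ⟨fun hs b => ?_, fun hs a => ?_⟩⟩
    · obtain ⟨a, ha⟩ := hA.exists_set h hl b
      exact (hΦ _ _ _ _ ha).1 (hs a)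
    · obtain ⟨b, hb⟩ := hA.symm.exists_set h hl a
      exact (hΦ _ _ _ _ hb).1 (hs b)

/-- Structures over the blocks of a split signature can be glued along given carriers, provided
that they agree on the predicate symbols of arity zero. -/
lemma IsSplitBy.exists_glue (h : S.IsSplitBy Λ T)
    (B : ∀ l, Structure.{u, v} (T l).toSignature) (C : S.Sorts → Type v)
    (e : ∀ l (σ : (T l).sorts), (B l).carrier σ ≃ C σ.1)
    (P : S.Rel → Prop) (hP : ∀ l (R : (T l).rels), S.relArity R.1 = 0 →
      ∀ x, ((B l).relMap R x ↔ P R.1)) :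
    ∃ M : Structure.{u, v} S, M.carrier = C ∧
      ∀ l, ∃ e' : ∀ σ, (B l).carrier σ ≃ (M.reduct (T l)).carrier σ, IsIso e' := by
  choose lf hlf using h.exists_mem_funcs
  choose lr hlr using h.exists_mem_rels
  choose ls hls using h.exists_mem_sorts
  refine ⟨{ carrier := C
            carrier_nonempty := fun σ =>
              ((B (ls σ)).carrier_nonempty (⟨σ, hls σ⟩ : (T (ls σ)).sorts)).map (e _ _)
            funMap := fun f x => e (lf f) ⟨_, (T (lf f)).funcCod_mem f (hlf f)⟩
              ((B (lf f)).funMap (⟨f, hlf f⟩ : (T (lf f)).funcs)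
                fun i => (e (lf f) ⟨_, (T (lf f)).funcDom_mem f (hlf f) i⟩).symm (x i))
            relMap := fun R x => (B (lr R)).relMap (⟨R, hlr R⟩ : (T (lr R)).rels)
                fun i => (e (lr R) ⟨_, (T (lr R)).relDom_mem R (hlr R) i⟩).symm (x i) }, rfl,
    fun l => ⟨e l, ?_, ?_⟩⟩
  · rintro ⟨f, hf⟩ x
    -- The codomain determines the block, so the chosen block is the given one.
    obtain rfl : lf f = l := h.eq_of_mem_sorts ((T (lf f)).funcCod_mem f (hlf f))
      ((T l).funcCod_mem f hf)
    refine congrArg (e (lf f) _) (congrArg ((B (lf f)).funMap _) (funext fun i => ?_))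
    exact ((e (lf f) _).symm_apply_apply (x i)).symm
  · rintro ⟨R, hR⟩ x
    by_cases hl : lr R = l
    · subst hl
      refine iff_of_eq (congrArg ((B (lr R)).relMap _) (funext fun i => ?_))
      exact ((e (lr R) _).symm_apply_apply (x i)).symm
    -- A first argument would determine the block, so a shared predicate symbol is nullary and `P`
    -- settles it.
    · have h0 : S.relArity R = 0 := by
        by_contra h0
        exact hl (h.eq_of_mem_sorts
          ((T (lr R)).relDom_mem R (hlr R) ⟨0, Nat.pos_of_ne_zero h0⟩)
          ((T l).relDom_mem R hR ⟨0, Nat.pos_of_ne_zero h0⟩))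
      exact (hP l ⟨R, hR⟩ h0 x).trans (hP (lr R) ⟨R, hlr R⟩ h0 _).symm

end Split

end Signature

end ManySorted

open ManySorted ManySorted.Signature ManySorted.Signature.Structure in
theorem mainTheorem7 (S : ManySorted.Signature.{u}) (Λ : Set (Set S.Sorts))
    (T : Λ → ManySorted.Signature.Subsignature S) (hsplit : S.IsSplitBy Λ T)
    (A : ManySorted.Signature.Structure.{u, v} S) (κ : Λ → Cardinal.{v})
    (hκ : ∀ l : Λ, max (Cardinal.lift.{v} (T l).toSignature.card) Cardinal.aleph0 ≤
      Cardinal.lift.{u} (κ l)) :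
    ∃ B : ManySorted.Signature.Structure.{u, v} S,
      A.ElementarilyEquivalent B ∧
      (∀ l : Λ, ∀ σ ∈ A.infiniteSorts ∩ (l : Set S.Sorts), Cardinal.mk (B.carrier σ) = κ l) ∧
      ∀ σ ∈ A.finiteSorts, B.carrier σ = A.carrier σ := by
  classical
  obtain ⟨ν⟩ := A.nonempty_assignment
  choose B μ hsat hinf hfin using fun l =>
    exists_equivalent_mk_eq (A.reduct (T l)) (ν.restrict (T l)) (κ l) (hκ l)
  choose ls hls using hsplit.exists_mem_sorts
  -- Finite sorts must keep the very same carrier, so the carriers are fixed before gluing.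
  let C : S.Sorts → Type v := fun σ =>
    if Finite (A.carrier σ) then A.carrier σ else (κ (ls σ)).out
  have hCfin : ∀ σ, Finite (A.carrier σ) → C σ = A.carrier σ := fun σ hσ => if_pos hσ
  have hCinf : ∀ l (σ : (T l).sorts), Infinite (A.carrier σ.1) → Cardinal.mk (C σ.1) = κ l :=
    fun l σ hσ => by
      simp only [C]
      rw [if_neg (not_finite_iff_infinite.2 hσ), Cardinal.mk_out,
        hsplit.eq_of_mem_sorts (hls σ.1) σ.2]
  have he : ∀ l (σ : (T l).sorts), Nonempty ((B l).carrier σ ≃ C σ.1) := fun l σ => by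
    rcases finite_or_infinite (A.carrier σ.1) with hσ | hσ
    · rw [hCfin σ.1 hσ]
      exact (hfin l σ hσ).map Equiv.symm
    · rw [← Cardinal.eq, hCinf l σ hσ]
      exact hinf l σ hσ
  -- For arity zero this is the truth value in `A`; other arities play no role.
  let P : S.Rel → Prop := fun R => ∀ x, A.relMap R x
  have hP : ∀ l (R : (T l).rels), S.relArity R.1 = 0 → ∀ x, ((B l).relMap R x ↔ P R.1) :=
    fun l R h0 x => by
      have : IsEmpty (Fin (S.relArity R.1)) := by rw [h0]; infer_instance
      -- Without arguments the variables are vacuous, and this atomic formula transfers the truth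
      -- value from `A`.
      have hR := hsat l (.rel (S := (T l).toSignature) R fun i => .var _ 0)
      have hA : P R.1 ↔ (A.reduct (T l)).Sat (ν.restrict (T l))
          (.rel (S := (T l).toSignature) R fun i => .var _ 0) :=
        ⟨fun h => h _, fun h y => (funext fun i => isEmptyElim i : _ = y) ▸ h⟩
      rw [hA, hR]
      exact iff_of_eq (congrArg ((B l).relMap R)
        (funext fun i : Fin (S.relArity R.1) => isEmptyElim i))
  obtain ⟨M, hMC, hM⟩ :=
    hsplit.exists_glue B C (fun l σ => Classical.choice (he l σ)) P hP
  choose e he using hM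
  -- The assignments of the blocks, transported along the isomorphisms; since each sort has only one
  -- block, `ξ` restricts to each of them.
  let ξ : M.Assignment := fun σ n =>
    e (ls σ) (⟨σ, hls σ⟩ : (T (ls σ)).sorts) (μ (ls σ) (⟨σ, hls σ⟩ : (T (ls σ)).sorts) n)
  have hξ : ∀ l, ξ.restrict (T l) = fun σ n => e l σ (μ l σ n) := fun l => by
    funext ⟨σ, hσ⟩ n
    obtain rfl : ls σ = l := hsplit.eq_of_mem_sorts (hls σ) hσ
    rfl
  refine ⟨M, fun φ hφ => ?_, fun l σ hσ => ?_, fun σ hσ => ?_⟩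
  · obtain ⟨Φ, hΦ⟩ := IsSplitBy.exists_agree.{u, v} hsplit φ
    rw [A.models_iff_sat hφ ν, M.models_iff_sat hφ ξ]
    -- Membership in the list is irrelevant: the blocks agree on all their formulas.
    refine hΦ A ν M ξ fun l ψ _ => ?_
    rw [hξ, ← (he l).sat]
    exact hsat l ψ
  · have hl : σ ∈ (T l).sorts := by rw [hsplit.sorts_eq]; exact hσ.2
    rw [hMC]
    exact hCinf l ⟨σ, hl⟩ (Cardinal.infinite_iff.2 hσ.1)
  · rw [hMC]
    exact hCfin σ (Cardinal.lt_aleph0_iff_finite.1 (not_le.1 hσ))
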